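/- Let $x$ be a real algebraic number and let $\mathrm{trig}$ be any of the six functions $\cos,\sin,\tan,\sec,\csc,\cot$. Then the number $\dfrac{\mathrm{arctrig}(x)}{\pi}$ is either rational or transcendental (over $\mathbb{Q}$). This holds for the principal value of the real function $\mathrm{arctrig}$ whenever $x$ lies in its natural domain ($|x|\le 1$ for $\arccos$ and $\arcsin$; $|x|\ge 1$ for $\mathrm{arcsec}$ and $\mathrm{arccsc}$; every real $x$ for $\arctan$ and $\mathrm{arccot}$), and, more generally, for every value of $\mathrm{arctrig}(x)$, that is, for every real or complex number $\theta$ at which $\mathrm{trig}$ is defined and such that $\mathrm{trig}(\theta)=x$. -/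

import Mathlib

/-- The six basic trigonometric functions. -/
inductive BasicTrig where
  | cos
  | sin
  | tan
  | sec
  | csc
  | cot

namespace BasicTrig

/-- The complex numbers at which the trigonometric function is defined (its poles are excluded). -/
def domain : BasicTrig → Set ℂ
  | cos => Set.univ
  | sin => Set.univ
  | tan => {θ | Complex.cos θ ≠ 0}
  | sec => {θ | Complex.cos θ ≠ 0}
  | csc => {θ | Complex.sin θ ≠ 0}
  | cot => {θ | Complex.sin θ ≠ 0}

/-- The trigonometric function itself, as a function of a complex variable. -/
noncomputable def eval : BasicTrig → ℂ → ℂ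
  | cos, θ => Complex.cos θ
  | sin, θ => Complex.sin θ
  | tan, θ => Complex.tan θ
  | sec, θ => 1 / Complex.cos θ
  | csc, θ => 1 / Complex.sin θ
  | cot, θ => Complex.cot θ

/-- All the (real or complex) values of `arctrig x`: the arcs `θ` with `trig θ = x`. -/
def arcValues (t : BasicTrig) (x : ℝ) : Set ℂ :=
  {θ | θ ∈ t.domain ∧ t.eval θ = (x : ℂ)}

/-- The natural domain of the real inverse trigonometric function. -/
def arcDomain : BasicTrig → Set ℝ
  | cos => Set.Icc (-1) 1
  | sin => Set.Icc (-1) 1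
  | tan => Set.univ
  | sec => {x | 1 ≤ |x|}
  | csc => {x | 1 ≤ |x|}
  | cot => Set.univ

/-- The principal value of the real inverse trigonometric function; `arccot` takes its values
in the interval from `0` to `π`. Meaningful for `x` in `arcDomain`. -/
noncomputable def arc : BasicTrig → ℝ → ℝ
  | cos, x => Real.arccos x
  | sin, x => Real.arcsin x
  | tan, x => Real.arctan x
  | sec, x => Real.arccos (1 / x)
  | csc, x => Real.arcsin (1 / x)
  | cot, x => Real.pi / 2 - Real.arctan x

end BasicTrig

/-! If `trig θ = x` with `x` algebraic, then `cos θ ^ 2`, and hence `exp (iθ)`, is algebraic; with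
`β = θ / π` so is `γ = exp (2πiβ) = exp (iθ) ^ 2`. It remains to see that `β` and `γ` cannot both be
algebraic when `β` is not rational (`transcendental_exp_two_pi_I_mul`).

This is Schneider's method. At the points `m + nβ` both `z` and `exp (2πiz)` take values in the
number field `ℚ(β, γ)`. Siegel's lemma gives a nonzero polynomial in these two functions, with small
algebraic integer coefficients, that vanishes for `m, n < t ^ 2`. Once it vanishes for `m, n < s ^
2`, the Schwarz lemma makes its values for `m, n < (s + 1) ^ 2` so small that Liouville's inequality
forces them to be 0 (`expPoly_vanishes_on_larger_grid`). By induction it vanishes at every `m + nβ`,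
so its coefficients are all 0 (`eq_zero_of_expPoly_eq_zero`), a contradiction. -/

/-! ### Zeros of entire functions -/

theorem exists_eq_prod_sub_mul (Z : Finset ℂ) {f : ℂ → ℂ} (hf : Differentiable ℂ f)
    (h0 : ∀ z ∈ Z, f z = 0) :
    ∃ g : ℂ → ℂ, Differentiable ℂ g ∧ ∀ z, f z = (∏ u ∈ Z, (z - u)) * g z := by
  classical
  induction Z using Finset.induction_on with
  | empty => exact ⟨f, hf, by simp⟩
  | insert a Z ha ih =>
    obtain ⟨g, hg, hfg⟩ := ih fun z hz => h0 z (Finset.mem_insert_of_mem hz)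
    have hga : g a = 0 := by
      have h := h0 a (Finset.mem_insert_self a Z)
      rw [hfg] at h
      refine (mul_eq_zero.1 h).resolve_left (Finset.prod_ne_zero_iff.2 fun u hu => ?_)
      rw [sub_ne_zero]
      rintro rfl
      exact ha hu
    refine ⟨dslope g a, ?_, fun z => ?_⟩
    · rw [← differentiableOn_univ] at hg ⊢
      exact (Complex.differentiableOn_dslope Filter.univ_mem).2 hg
    · have h := sub_smul_dslope g a z
      rw [hga, sub_zero, smul_eq_mul] at h
      rw [hfg, ← h, Finset.prod_insert ha]
      ring

/-- A Schwarz lemma for an entire function with many zeros. -/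
theorem norm_le_mul_pow_of_zeros {Z : Finset ℂ} {f : ℂ → ℂ} (hf : Differentiable ℂ f)
    (h0 : ∀ z ∈ Z, f z = 0) {r R M : ℝ} (hrR : r < R) (hZ : ∀ z ∈ Z, ‖z‖ ≤ r)
    (hM : ∀ z, ‖z‖ = R → ‖f z‖ ≤ M) {w : ℂ} (hw : ‖w‖ ≤ r) :
    ‖f w‖ ≤ M * (2 * r / (R - r)) ^ Z.card := by
  obtain ⟨g, hg, hfg⟩ := exists_eq_prod_sub_mul Z hf h0
  have hr : 0 ≤ r := (norm_nonneg w).trans hw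
  have hRr : 0 < R - r := sub_pos.2 hrR
  have hgw : ‖g w‖ ≤ M / (R - r) ^ Z.card := by
    -- Maximum principle for the quotient `g`: on the circle of radius `R` every factor satisfies
    -- `‖z - u‖ ≥ R - r`.
    refine Complex.norm_le_of_forall_mem_frontier_norm_le (U := Metric.ball 0 R)
      Metric.isBounded_ball hg.diffContOnCl (fun z hz => ?_)
      (subset_closure (mem_ball_zero_iff.2 (hw.trans_lt hrR)))
    rw [frontier_ball 0 (hr.trans_lt hrR).ne', mem_sphere_zero_iff_norm] at hz
    rw [le_div_iff₀ (by positivity)]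
    calc ‖g z‖ * (R - r) ^ Z.card = (∏ _u ∈ Z, (R - r)) * ‖g z‖ := by
          rw [Finset.prod_const, mul_comm]
      _ ≤ (∏ u ∈ Z, ‖z - u‖) * ‖g z‖ := by
          gcongr with u hu
          have := norm_sub_norm_le z u
          linarith [hZ u hu]
      _ = ‖f z‖ := by rw [hfg, norm_mul, norm_prod]
      _ ≤ M := hM z hz
  calc ‖f w‖ = (∏ u ∈ Z, ‖w - u‖) * ‖g w‖ := by rw [hfg, norm_mul, norm_prod]
    _ ≤ (∏ _u ∈ Z, (2 * r)) * (M / (R - r) ^ Z.card) := by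
        gcongr with u hu
        linarith [norm_sub_le w u, hZ u hu]
    _ = M * (2 * r / (R - r)) ^ Z.card := by
        rw [Finset.prod_const, div_pow]
        ring

/-! ### Exponential polynomials on the grid `m + nβ` -/

/-- A polynomial in `z` and `exp (2πiz)`. -/
noncomputable def expPoly {D L : ℕ} (a : Fin D × Fin L → ℂ) (z : ℂ) : ℂ :=
  ∑ i, a i * (z ^ (i.1 : ℕ) * Complex.exp (2 * Real.pi * Complex.I * z) ^ (i.2 : ℕ))

theorem differentiable_expPoly {D L : ℕ} (a : Fin D × Fin L → ℂ) :
    Differentiable ℂ (expPoly a) := by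
  unfold expPoly
  fun_prop

theorem exp_two_pi_I_mul_nat_add (β : ℂ) (m n : ℕ) :
    Complex.exp (2 * Real.pi * Complex.I * (m + n * β)) =
      Complex.exp (2 * Real.pi * Complex.I * β) ^ n := by
  rw [← Complex.exp_nat_mul, mul_add, Complex.exp_add,
    show 2 * Real.pi * Complex.I * (m : ℂ) = m * (2 * Real.pi * Complex.I) by ring,
    Complex.exp_nat_mul_two_pi_mul_I, one_mul]
  congr 1
  ring

theorem expPoly_nat_add {D L : ℕ} (a : Fin D × Fin L → ℂ) (β : ℂ) (m n : ℕ) :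
    expPoly a (m + n * β) = ∑ i, a i * ((m + n * β) ^ (i.1 : ℕ) *
      Complex.exp (2 * Real.pi * Complex.I * β) ^ (n * (i.2 : ℕ))) := by
  simp only [expPoly, exp_two_pi_I_mul_nat_add, pow_mul]

theorem norm_expPoly_le {D L : ℕ} {a : Fin D × Fin L → ℂ} {A R : ℝ} (hA : ∀ i, ‖a i‖ ≤ A)
    (hR : 1 ≤ R) {z : ℂ} (hz : ‖z‖ = R) :
    ‖expPoly a z‖ ≤ (D * L : ℕ) * (A * (R ^ D * Real.exp (7 * R) ^ L)) := by
  have h : ∀ i ∈ Finset.univ, ‖a i * (z ^ (i.1 : ℕ) *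
      Complex.exp (2 * Real.pi * Complex.I * z) ^ (i.2 : ℕ))‖ ≤
        A * (R ^ D * Real.exp (7 * R) ^ L) := by
    intro i _
    have hA0 : 0 ≤ A := (norm_nonneg _).trans (hA i)
    rw [norm_mul, norm_mul, norm_pow, norm_pow, hz]
    have h1 : ‖Complex.exp (2 * Real.pi * Complex.I * z)‖ ≤ Real.exp (7 * R) := by
      refine (Complex.norm_exp_le_exp_norm _).trans (Real.exp_le_exp.2 ?_)
      simp only [norm_mul, hz, Complex.norm_I, Complex.norm_ofNat, Complex.norm_real,
        Real.norm_eq_abs, abs_of_pos Real.pi_pos]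
      -- The constant 7 is an integer bound for `2π`.
      have := Real.pi_lt_d2
      nlinarith
    have h2 : 1 ≤ Real.exp (7 * R) := Real.one_le_exp (by linarith)
    gcongr
    · exact hA i
    · exact i.1.2.le
    · exact (pow_le_pow_left₀ (norm_nonneg _) h1 _).trans (pow_le_pow_right₀ h2 i.2.2.le)
  refine (norm_sum_le_of_le _ h).trans (le_of_eq ?_)
  simp

theorem nat_add_mul_injective {β : ℂ} (hβ : ∀ q : ℚ, β ≠ q) :
    Function.Injective fun p : ℕ × ℕ => (p.1 + p.2 * β : ℂ) := by
  rintro ⟨m, n⟩ ⟨m', n'⟩ h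
  simp only at h
  by_cases hn : n = n'
  · subst hn
    simpa using h
  · exfalso
    have hn' : (n : ℂ) - n' ≠ 0 := sub_ne_zero.2 (by exact_mod_cast hn)
    refine hβ (((m' : ℚ) - m) / (n - n')) ?_
    push_cast
    rw [eq_div_iff hn']
    linear_combination h

theorem exp_two_pi_I_mul_pow_injective {β : ℂ} (hβ : ∀ q : ℚ, β ≠ q) :
    Function.Injective fun n : ℕ => Complex.exp (2 * Real.pi * Complex.I * β) ^ n := by
  intro n n' h
  simp only [← Complex.exp_nat_mul] at h
  obtain ⟨k, hk⟩ := Complex.exp_eq_exp_iff_exists_int.1 h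
  by_contra hn
  have hn' : (n : ℂ) - n' ≠ 0 := sub_ne_zero.2 (by exact_mod_cast hn)
  refine hβ ((k : ℚ) / (n - n')) ?_
  push_cast
  rw [eq_div_iff hn']
  refine mul_left_cancel₀ Complex.two_pi_I_ne_zero ?_
  linear_combination hk

theorem sum_mul_pow_eq_zero_of_infinite {F : Type*} [Field F] {D : ℕ} {a : Fin D → F} {S : Set F}
    (hS : S.Infinite) (h : ∀ x ∈ S, ∑ j, a j * x ^ (j : ℕ) = 0) : a = 0 := by
  have hp : (∑ j, Polynomial.C (a j) * Polynomial.X ^ (j : ℕ) : Polynomial F) = 0 := by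
    refine Polynomial.eq_zero_of_infinite_isRoot _ (hS.mono fun x hx => ?_)
    simpa [Polynomial.IsRoot, Polynomial.eval_finsetSum] using h x hx
  funext j
  have hj := congrArg (fun p => Polynomial.coeff p (j : ℕ)) hp
  simpa [Polynomial.finsetSum_coeff, Polynomial.coeff_C_mul, Polynomial.coeff_X_pow,
    Fin.val_inj] using hj

/-- The exponential at `m + nβ` depends only on `n`. For fixed `n` this leaves a polynomial in `z`
with infinitely many roots; its coefficients are polynomials in the exponential that vanish at the
infinitely many distinct powers `γ ^ n`. -/
theorem eq_zero_of_expPoly_eq_zero {D L : ℕ} {a : Fin D × Fin L → ℂ} {β : ℂ}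
    (hβ : ∀ q : ℚ, β ≠ q) (h : ∀ m n : ℕ, expPoly a (m + n * β) = 0) : a = 0 := by
  have h1 : ∀ n : ℕ, (fun j : Fin D => ∑ k : Fin L,
      a (j, k) * (Complex.exp (2 * Real.pi * Complex.I * β) ^ n) ^ (k : ℕ)) = 0 := by
    intro n
    have hinj : Function.Injective fun m : ℕ => (m + n * β : ℂ) := fun m m' hm => by
      simpa using hm
    refine sum_mul_pow_eq_zero_of_infinite (Set.infinite_range_of_injective hinj) ?_
    rintro _ ⟨m, rfl⟩
    have hmn := h m n
    rw [expPoly_nat_add, Fintype.sum_prod_type] at hmn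
    rw [← hmn]
    refine Finset.sum_congr rfl fun j _ => ?_
    rw [Finset.sum_mul]
    refine Finset.sum_congr rfl fun k _ => ?_
    rw [pow_mul]
    ring
  funext ⟨j, k⟩
  have h2 : (fun k => a (j, k)) = 0 := by
    refine sum_mul_pow_eq_zero_of_infinite
      (Set.infinite_range_of_injective (exp_two_pi_I_mul_pow_injective hβ)) ?_
    rintro _ ⟨n, rfl⟩
    exact congrFun (h1 n) j
  exact congrFun h2 k

/-! ### Siegel's lemma and Liouville's inequality -/

section NumberField

open NumberField

/-- With twice as many unknowns as equations, the exponent `p / (q - p)` in Siegel's lemma is 1. -/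
theorem exists_siegel_bound (K : Type*) [Field K] [NumberField K] :
    ∃ c : ℝ, 1 ≤ c ∧ ∀ {α β : Type} [Fintype α] [Fintype β] (M : Matrix α β (𝓞 K)) (A : ℝ),
      0 < Fintype.card α → Fintype.card β = 2 * Fintype.card α → M ≠ 0 →
      (∀ k l, house (M k l : K) ≤ A) →
      ∃ ξ : β → 𝓞 K, ξ ≠ 0 ∧ M.mulVec ξ = 0 ∧
        ∀ l, house (ξ l : K) ≤ c * (Fintype.card β * A) := by
  classical
  obtain ⟨c, hc⟩ : ∃ c : ℝ, ∀ {α β : Type} [Fintype α] [Fintype β] (M : Matrix α β (𝓞 K))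
      (A : ℝ), 0 < Fintype.card α → Fintype.card α < Fintype.card β → M ≠ 0 →
      (∀ k l, house (M k l : K) ≤ A) →
      ∃ ξ : β → 𝓞 K, ξ ≠ 0 ∧ M.mulVec ξ = 0 ∧
        ∀ l, house (ξ l : K) ≤ c * ((c * (Fintype.card β : ℕ) * A) ^
          (((Fintype.card α : ℕ) : ℝ) / ((Fintype.card β : ℕ) - (Fintype.card α : ℕ)))) :=
    ⟨_, fun {α β} _ _ M A h0 h1 hM hA =>
      house.exists_ne_zero_int_vec_house_le K M hM h0 h1 rfl hA rfl⟩
  refine ⟨max 1 (c ^ 2), le_max_left _ _, fun {α β} _ _ M A h0 h1 hM hA => ?_⟩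
  obtain ⟨ξ, hξ, hMξ, hb⟩ := hc M A h0 (by omega) hM hA
  refine ⟨ξ, hξ, hMξ, fun l => (hb l).trans ?_⟩
  have hA0 : 0 ≤ A := by
    obtain ⟨k⟩ := Fintype.card_pos_iff.1 h0
    exact (house_nonneg _).trans (hA k l)
  have hα : (Fintype.card α : ℝ) ≠ 0 := by positivity
  rw [h1]
  push_cast
  rw [show (Fintype.card α : ℝ) / (2 * Fintype.card α - Fintype.card α) = 1 by
    rw [div_eq_one_iff_eq] <;> [ring; (ring_nf; exact hα)], Real.rpow_one]
  calc c * (c * (2 * Fintype.card α) * A) = c ^ 2 * (2 * Fintype.card α * A) := by ring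
    _ ≤ max 1 (c ^ 2) * (2 * Fintype.card α * A) := by
      gcongr
      exact le_max_right _ _

theorem isIntegral_natCast_int {R : Type*} [Ring R] (k : ℕ) : IsIntegral ℤ (k : R) := by
  simpa using isIntegral_algebraMap (R := ℤ) (A := R) (x := k)

theorem isIntegral_pow_mul {K : Type*} [Field K] {b g : K} {c : ℕ} (hb : IsIntegral ℤ (c * b))
    (hg : IsIntegral ℤ (c * g)) (m n : ℕ) {j r E : ℕ} (h : j + r ≤ E) :
    IsIntegral ℤ (c ^ E * ((m + n * b) ^ j * g ^ r)) := by
  obtain ⟨e, rfl⟩ := Nat.exists_eq_add_of_le h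
  have : (c : K) ^ (j + r + e) * ((m + n * b) ^ j * g ^ r) =
      c ^ e * ((c * m + n * (c * b)) ^ j * (c * g) ^ r) := by
    rw [show (c * m + n * (c * b) : K) = c * (m + n * b) by ring, mul_pow, mul_pow]
    ring
  rw [this]
  have hn := isIntegral_natCast_int (R := K)
  exact ((hn c).pow e).mul (((((hn c).mul (hn m)).add ((hn n).mul hb)).pow j).mul (hg.pow r))

variable {K : Type*} [Field K] [NumberField K]

theorem house_natCast (n : ℕ) : house (n : K) = n := by
  simpa using house_intCast (K := K) n

theorem house_pow_mul_le {b g : K} {c P j r D s m n : ℕ} {H : ℝ} (hH : 1 ≤ H)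
    (hb : 1 + house b ≤ H) (hg : house g ≤ H) (hc : 1 ≤ c) (hP : 1 ≤ P) (hm : m ≤ P) (hn : n ≤ P)
    (hj : j ≤ D) (hr : r ≤ s) :
    house (c ^ (D + s) * ((m + n * b) ^ j * g ^ r)) ≤ (c * H) ^ (D + s) * P ^ D := by
  have h1 : house ((m + n * b) ^ j) ≤ (P * H) ^ D := by
    refine (house_pow_le _ _).trans ?_
    have hPH : 1 ≤ (P : ℝ) * H := one_le_mul_of_one_le_of_one_le (by exact_mod_cast hP) hH
    refine (pow_le_pow_left₀ (house_nonneg _) ?_ j).trans (pow_le_pow_right₀ hPH hj)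
    calc house (m + n * b) ≤ house (m : K) + house (n * b) := house_add_le _ _
      _ = m + n * house b := by rw [house_natCast, house_nat_mul]
      _ ≤ P + P * house b := by
        have := house_nonneg b
        gcongr
      _ = P * (1 + house b) := by ring
      _ ≤ P * H := by gcongr
  have h2 : house (g ^ r) ≤ H ^ s :=
    (house_pow_le _ _).trans
      ((pow_le_pow_left₀ (house_nonneg _) hg r).trans (pow_le_pow_right₀ hH hr))
  calc house (c ^ (D + s) * ((m + n * b) ^ j * g ^ r))
      = c ^ (D + s) * house ((m + n * b) ^ j * g ^ r) := by
        rw [← Nat.cast_pow, house_nat_mul, Nat.cast_pow]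
    _ ≤ c ^ (D + s) * ((P * H) ^ D * H ^ s) := by
        gcongr
        exact (house_mul_le _ _).trans (mul_le_mul h1 h2 (house_nonneg _) (by positivity))
    _ = (c * H) ^ (D + s) * P ^ D := by ring

/-- Liouville's inequality. -/
theorem one_le_norm_mul_house_pow {ξ : K} (hξ : IsIntegral ℤ ξ) (h0 : ξ ≠ 0) (σ : K →+* ℂ) :
    1 ≤ ‖σ ξ‖ * house ξ ^ (Module.finrank ℚ K - 1) := by
  refine le_trans ?_ (norm_norm_le_norm_mul_house_pow ξ σ)
  -- The norm of a nonzero algebraic integer is a nonzero rational integer.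
  obtain ⟨k, hk⟩ := IsIntegrallyClosed.isIntegral_iff.1 (Algebra.isIntegral_norm ℚ hξ)
  have hne : Algebra.norm ℚ ξ ≠ 0 := Algebra.norm_ne_zero_iff.2 h0
  rw [← hk] at hne ⊢
  have hk0 : k ≠ 0 := by rintro rfl; simp at hne
  rw [eq_intCast, ← Rat.norm_cast_real]
  have : (1 : ℝ) ≤ |(k : ℝ)| := by exact_mod_cast Int.one_le_abs hk0
  simpa using this

/-- There are `t ^ 4` equations in `2 * t ^ 4` unknowns. Degree about `t ^ 3` in `z` and `t` in the
exponential balance, as the exponents of `g` are then also at most `t ^ 3`. -/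
theorem exists_siegel_coeffs {b g : K} {c : ℕ} (hc : 1 ≤ c) (hcb : IsIntegral ℤ (c * b))
    (hcg : IsIntegral ℤ (c * g)) {H : ℝ} (hH : 1 ≤ H) (hb : 1 + house b ≤ H)
    (hg : house g ≤ H) :
    ∃ C : ℝ, 1 ≤ C ∧ ∀ t : ℕ, 1 ≤ t → ∃ a : Fin (2 * t ^ 3) × Fin t → 𝓞 K, a ≠ 0 ∧
      (∀ m n : ℕ, m < t ^ 2 → n < t ^ 2 →
        ∑ i, (a i : K) * ((m + n * b) ^ (i.1 : ℕ) * g ^ (n * (i.2 : ℕ))) = 0) ∧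
      ∀ i, house (a i : K) ≤
        C * ((2 * t ^ 4) * ((c * H) ^ (2 * t ^ 3 + t ^ 3) * (t ^ 2) ^ (2 * t ^ 3))) := by
  obtain ⟨C, hC1, hC⟩ := exists_siegel_bound K
  refine ⟨C, hC1, fun t ht => ?_⟩
  have ht2 : 1 ≤ t ^ 2 := Nat.one_le_pow _ _ ht
  have hexp : ∀ (n : Fin (t ^ 2)) (k : Fin t), (n : ℕ) * k ≤ t ^ 3 := fun n k => by
    calc (n : ℕ) * k ≤ t ^ 2 * t := Nat.mul_le_mul n.2.le k.2.le
      _ = t ^ 3 := by ring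
  let M : Matrix (Fin (t ^ 2) × Fin (t ^ 2)) (Fin (2 * t ^ 3) × Fin t) (𝓞 K) := fun k l =>
    ⟨c ^ (2 * t ^ 3 + t ^ 3) * (((k.1 : ℕ) + (k.2 : ℕ) * b) ^ (l.1 : ℕ) *
      g ^ ((k.2 : ℕ) * (l.2 : ℕ))),
      isIntegral_pow_mul hcb hcg _ _ (add_le_add l.1.2.le (hexp _ _))⟩
  have hc0 : (c : K) ≠ 0 := by exact_mod_cast (by omega : c ≠ 0)
  -- The entry with all indices 0 is a power of `c`, because `0 ^ 0 = 1`.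
  have hM0 : M ≠ 0 := by
    intro h
    have h1 := congrArg (algebraMap (𝓞 K) K) (congrFun (congrFun h (⟨0, ht2⟩, ⟨0, ht2⟩))
      (⟨0, by positivity⟩, ⟨0, ht⟩))
    simp [M, hc0] at h1
  have hMH : ∀ k l, house (M k l : K) ≤
      (c * H) ^ (2 * t ^ 3 + t ^ 3) * (t ^ 2) ^ (2 * t ^ 3) := fun k l => by
    have := house_pow_mul_le (b := b) (g := g) hH hb hg hc ht2 k.1.2.le k.2.2.le l.1.2.le
      (hexp k.2 l.2)
    rw [Nat.cast_pow] at this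
    exact this
  obtain ⟨ξ, hξ0, hMξ, hξ⟩ := hC M _ (by simp; omega) (by simp; ring) hM0 hMH
  refine ⟨ξ, hξ0, fun m n hm hn => ?_, fun i => (hξ i).trans (le_of_eq ?_)⟩
  · have h1 := congrArg (algebraMap (𝓞 K) K) (congrFun hMξ (⟨m, hm⟩, ⟨n, hn⟩))
    simp only [Matrix.mulVec, dotProduct, map_sum, map_mul, Pi.zero_apply, map_zero] at h1
    have h2 : (c : K) ^ (2 * t ^ 3 + t ^ 3) * ∑ i, (ξ i : K) *
        ((m + n * b) ^ (i.1 : ℕ) * g ^ (n * (i.2 : ℕ))) = 0 := by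
      rw [← h1, Finset.mul_sum]
      refine Finset.sum_congr rfl fun i _ => ?_
      rw [mul_left_comm, mul_comm]
      rfl
    exact (mul_eq_zero.1 h2).resolve_left (pow_ne_zero _ hc0)
  · congr 2
    simp
    ring

/-- The factor `S ^ (-s ^ 4)` is split evenly: one half absorbs `S ^ (A * s ^ 3)`, the other `G ^ s
^ 4`. Squaring avoids the square roots. -/
theorem pow_lt_of_sq_lt {S G : ℝ} {A s : ℕ} (hS : 1 ≤ S) (hGS : G ^ 2 < S)
    (hA : 2 * A ≤ s) (hs : s ≠ 0) : S ^ (A * s ^ 3) * (G / S) ^ s ^ 4 < 1 := by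
  have hS0 : 0 < S := by linarith
  have h : (S ^ (A * s ^ 3) * G ^ s ^ 4) ^ 2 < (S ^ s ^ 4) ^ 2 := by
    calc (S ^ (A * s ^ 3) * G ^ s ^ 4) ^ 2 = S ^ (2 * A * s ^ 3) * (G ^ 2) ^ s ^ 4 := by
          rw [mul_pow, ← pow_mul, ← pow_mul, ← pow_mul]
          ring
      _ < S ^ s ^ 4 * S ^ s ^ 4 := by
        refine mul_lt_mul' (pow_le_pow_right₀ hS ?_)
          (pow_lt_pow_left₀ hGS (by positivity) (by positivity)) (by positivity) (by positivity)
        calc 2 * A * s ^ 3 ≤ s * s ^ 3 := by gcongr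
          _ = s ^ 4 := by ring
      _ = (S ^ s ^ 4) ^ 2 := by ring
  rw [div_pow, ← mul_div_assoc, div_lt_one (by positivity)]
  exact lt_of_pow_lt_pow_left₀ 2 (by positivity) h

/-! ### Numerical estimates for large `s` -/

section Estimates

variable {s t : ℕ} {C : ℝ}

theorem siegel_bound_le {C₁ : ℝ} (hC : 1 ≤ C) (ht : 2 ≤ t) (hts : t ≤ s)
    (hC₁s : C₁ ≤ s) (hCs : C ≤ s) :
    C₁ * ((2 * t ^ 4) * (C ^ (2 * t ^ 3 + t ^ 3) * (t ^ 2) ^ (2 * t ^ 3))) ≤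
      (s : ℝ) ^ (13 * s ^ 3) := by
  have hs1 : (1 : ℝ) ≤ s := by exact_mod_cast (by omega : 1 ≤ s)
  have hts' : (t : ℝ) ≤ s := by exact_mod_cast hts
  have h2s : (2 : ℝ) ≤ s := by exact_mod_cast ht.trans hts
  have h3 : t ^ 3 ≤ s ^ 3 := Nat.pow_le_pow_left hts 3
  have hs3 : 1 ≤ s ^ 3 := Nat.one_le_pow _ _ (by omega)
  calc C₁ * ((2 * t ^ 4) * (C ^ (2 * t ^ 3 + t ^ 3) * ((t : ℝ) ^ 2) ^ (2 * t ^ 3)))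
      ≤ s * ((s * s ^ 4) * (s ^ (2 * t ^ 3 + t ^ 3) * (s ^ 2) ^ (2 * t ^ 3))) := by gcongr
    _ = (s : ℝ) ^ (6 + 7 * t ^ 3) := by rw [← pow_mul]; ring
    _ ≤ (s : ℝ) ^ (13 * s ^ 3) := pow_le_pow_right₀ hs1 (by omega)

theorem succ_sq_le (hs : 4 ≤ s) : (s + 1) ^ 2 ≤ s ^ 3 := by nlinarith [sq_nonneg s]

theorem exponent_le (hts : t ≤ s) (hs : 4 ≤ s) :
    2 * t ^ 3 + (s + 1) ^ 2 * t ≤ 6 * s ^ 3 := by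
  have h3 : t ^ 3 ≤ s ^ 3 := Nat.pow_le_pow_left hts 3
  have h4 : (s + 1) ^ 2 * t ≤ (4 * s ^ 2) * s := Nat.mul_le_mul (by nlinarith) hts
  nlinarith

theorem monomial_bound_le (hC : 1 ≤ C) (hts : t ≤ s) (hs : 4 ≤ s) (hCs : C ≤ s) :
    C ^ (2 * t ^ 3 + (s + 1) ^ 2 * t) * (((s + 1) ^ 2 : ℕ) : ℝ) ^ (2 * t ^ 3) ≤
      (s : ℝ) ^ (12 * s ^ 3) := by
  have hs1 : (1 : ℝ) ≤ s := by exact_mod_cast (by omega : 1 ≤ s)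
  have h3 : t ^ 3 ≤ s ^ 3 := Nat.pow_le_pow_left hts 3
  have h1 : (((s + 1) ^ 2 : ℕ) : ℝ) ≤ (s : ℝ) ^ 3 := by exact_mod_cast succ_sq_le hs
  calc C ^ (2 * t ^ 3 + (s + 1) ^ 2 * t) * (((s + 1) ^ 2 : ℕ) : ℝ) ^ (2 * t ^ 3)
      ≤ (s : ℝ) ^ (2 * t ^ 3 + (s + 1) ^ 2 * t) * ((s : ℝ) ^ 3) ^ (2 * t ^ 3) := by gcongr
    _ ≤ (s : ℝ) ^ (6 * s ^ 3) * (s : ℝ) ^ (6 * s ^ 3) := by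
      rw [← pow_mul]
      gcongr ?_ * ?_
      · exact pow_le_pow_right₀ hs1 (exponent_le hts hs)
      · exact pow_le_pow_right₀ hs1 (by omega)
    _ = (s : ℝ) ^ (12 * s ^ 3) := by rw [← pow_add]; congr 1; ring

theorem card_le (hts : t ≤ s) (hs : 2 ≤ s) : ((2 * t ^ 3 * t : ℕ) : ℝ) ≤ (s : ℝ) ^ (5 * s ^ 3) := by
  have hs3 : 1 ≤ s ^ 3 := Nat.one_le_pow _ _ (by omega)
  have : 2 * t ^ 3 * t ≤ s ^ (5 * s ^ 3) := by
    calc 2 * t ^ 3 * t ≤ s * s ^ 3 * s := by gcongr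
      _ = s ^ 5 := by ring
      _ ≤ s ^ (5 * s ^ 3) := Nat.pow_le_pow_right (by omega) (by omega)
  exact_mod_cast this

theorem growth_le (hts : t ≤ s) (hs : 2 ≤ s) :
    ((2 * t ^ 3 * t : ℕ) : ℝ) * ((s : ℝ) ^ (13 * s ^ 3) * (((s : ℝ) ^ 3) ^ (2 * t ^ 3) *
      Real.exp (7 * (s : ℝ) ^ 3) ^ t)) ≤ (s : ℝ) ^ (24 * s ^ 3) * Real.exp 7 ^ s ^ 4 := by
  have hs1 : (1 : ℝ) ≤ s := by exact_mod_cast (by omega : 1 ≤ s)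
  have h3 : t ^ 3 ≤ s ^ 3 := Nat.pow_le_pow_left hts 3
  have h1 : Real.exp (7 * (s : ℝ) ^ 3) ^ t ≤ Real.exp 7 ^ s ^ 4 := by
    have : Real.exp (7 * (s : ℝ) ^ 3) = Real.exp 7 ^ s ^ 3 := by
      rw [← Real.exp_nat_mul]
      push_cast
      ring_nf
    rw [this, ← pow_mul]
    refine pow_le_pow_right₀ (Real.one_le_exp (by norm_num)) ?_
    calc s ^ 3 * t ≤ s ^ 3 * s := by gcongr
      _ = s ^ 4 := by ring
  calc _ ≤ (s : ℝ) ^ (5 * s ^ 3) * ((s : ℝ) ^ (13 * s ^ 3) * ((s : ℝ) ^ (6 * s ^ 3) *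
        Real.exp 7 ^ s ^ 4)) := by
        gcongr ?_ * (_ * (?_ * ?_))
        · exact card_le hts hs
        · rw [← pow_mul]
          exact pow_le_pow_right₀ hs1 (by omega)
    _ = (s : ℝ) ^ (24 * s ^ 3) * Real.exp 7 ^ s ^ 4 := by
      rw [← mul_assoc, ← mul_assoc, ← pow_add, ← pow_add]
      congr 2
      ring

end Estimates

/-! ### Extrapolation to larger grids -/

theorem map_sum_eq_expPoly {b g : K} (σ : K →+* ℂ)
    (hg : Complex.exp (2 * Real.pi * Complex.I * σ b) = σ g) {D L : ℕ}
    (a : Fin D × Fin L → 𝓞 K) (m n : ℕ) :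
    σ (∑ i, (a i : K) * ((m + n * b) ^ (i.1 : ℕ) * g ^ (n * (i.2 : ℕ)))) =
      expPoly (fun i => σ (a i)) (m + n * σ b) := by
  simp [expPoly_nat_add, hg]

/-- An exponential polynomial with small algebraic coefficients which vanishes on a large grid
vanishes on a larger grid. -/
theorem expPoly_vanishes_on_larger_grid {b g : K} {c : ℕ} (hc : 1 ≤ c)
    (hcb : IsIntegral ℤ (c * b)) (hcg : IsIntegral ℤ (c * g)) {H : ℝ} (hb : 1 + house b ≤ H)
    (hg : house g ≤ H) (σ : K →+* ℂ) (hirr : ∀ q : ℚ, σ b ≠ q)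
    (hbg : Complex.exp (2 * Real.pi * Complex.I * σ b) = σ g) {s t : ℕ} (hts : t ≤ s)
    (hs : 4 ≤ s) (hHs : 8 * H ≤ s) (hcHs : c * H ≤ s) (hGs : (16 * H * Real.exp 7) ^ 2 < s)
    (hd : 2 * (30 * Module.finrank ℚ K) ≤ s) {a : Fin (2 * t ^ 3) × Fin t → 𝓞 K}
    (ha : ∀ i, house (a i : K) ≤ (s : ℝ) ^ (13 * s ^ 3))
    (h0 : ∀ m n : ℕ, m < s ^ 2 → n < s ^ 2 → expPoly (fun i => σ (a i)) (m + n * σ b) = 0)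
    {m n : ℕ} (hm : m < (s + 1) ^ 2) (hn : n < (s + 1) ^ 2) :
    expPoly (fun i => σ (a i)) (m + n * σ b) = 0 := by
  by_contra hne
  have hH : 1 ≤ H := by linarith [house_nonneg b]
  have hs1 : (1 : ℝ) ≤ s := by exact_mod_cast (by omega : 1 ≤ s)
  have hs0 : (0 : ℝ) < s := by linarith
  have hc1 : (1 : ℝ) ≤ c := by exact_mod_cast hc
  set E := 2 * t ^ 3 + (s + 1) ^ 2 * t with hE
  have hexp : ∀ k : Fin t, n * (k : ℕ) ≤ (s + 1) ^ 2 * t := fun k => Nat.mul_le_mul hn.le k.2.le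
  -- The value at the new point, cleared of denominators by `c ^ E`.
  set ξ : K := ∑ i, (a i : K) * (c ^ E * ((m + n * b) ^ (i.1 : ℕ) * g ^ (n * (i.2 : ℕ)))) with hξ
  have hξint : IsIntegral ℤ ξ := IsIntegral.sum _ fun i _ =>
    (a i).isIntegral_coe.mul
      (isIntegral_pow_mul hcb hcg _ _ (add_le_add i.1.2.le (hexp i.2)))
  have hσξ : σ ξ = c ^ E * expPoly (fun i => σ (a i)) (m + n * σ b) := by
    rw [← map_sum_eq_expPoly σ hbg, ← map_natCast σ, ← map_pow, ← map_mul, Finset.mul_sum, hξ]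
    congr 1
    exact Finset.sum_congr rfl fun i _ => by ring
  have hξ0 : ξ ≠ 0 := by
    intro h
    rw [h, map_zero, eq_comm, mul_eq_zero] at hσξ
    refine hσξ.elim (pow_ne_zero _ ?_) hne
    exact_mod_cast (by omega : c ≠ 0)
  have hhouse : house ξ ≤ (s : ℝ) ^ (30 * s ^ 3) := by
    calc house ξ ≤ ∑ i, house ((a i : K) *
          (c ^ E * ((m + n * b) ^ (i.1 : ℕ) * g ^ (n * (i.2 : ℕ))))) :=
          house_sum_le_sum_house _ _
      _ ≤ ∑ _i : Fin (2 * t ^ 3) × Fin t, (s : ℝ) ^ (13 * s ^ 3) * (s : ℝ) ^ (12 * s ^ 3) := by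
        refine Finset.sum_le_sum fun i _ => (house_mul_le _ _).trans ?_
        refine mul_le_mul (ha i) ?_ (house_nonneg _) (by positivity)
        exact (house_pow_mul_le hH hb hg hc (Nat.one_le_pow _ _ (by omega)) hm.le hn.le
          i.1.2.le (hexp i.2)).trans
          (monomial_bound_le (one_le_mul_of_one_le_of_one_le hc1 hH) hts hs hcHs)
      _ = ((2 * t ^ 3 * t : ℕ) : ℝ) * ((s : ℝ) ^ (13 * s ^ 3) * (s : ℝ) ^ (12 * s ^ 3)) := by
        simp
      _ ≤ (s : ℝ) ^ (5 * s ^ 3) * ((s : ℝ) ^ (13 * s ^ 3) * (s : ℝ) ^ (12 * s ^ 3)) := by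
        gcongr
        exact card_le hts (by omega)
      _ = (s : ℝ) ^ (30 * s ^ 3) := by
        rw [← pow_add, ← pow_add]
        congr 1
        ring
  have hpt : ∀ m' n' : ℕ, m' < (s + 1) ^ 2 → n' < (s + 1) ^ 2 →
      ‖(m' + n' * σ b : ℂ)‖ ≤ 4 * s ^ 2 * H := by
    intro m' n' hm' hn'
    have h4 : (s + 1) ^ 2 ≤ 4 * s ^ 2 := by nlinarith
    have hm4 : (m' : ℝ) ≤ 4 * s ^ 2 := by exact_mod_cast hm'.le.trans h4
    have hn4 : (n' : ℝ) ≤ 4 * s ^ 2 := by exact_mod_cast hn'.le.trans h4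
    have hσb := norm_embedding_le_house b σ
    calc ‖(m' + n' * σ b : ℂ)‖ ≤ m' + n' * ‖σ b‖ := by
          refine (norm_add_le _ _).trans (le_of_eq ?_)
          simp
      _ ≤ 4 * s ^ 2 + 4 * s ^ 2 * house b := by gcongr
      _ = 4 * s ^ 2 * (1 + house b) := by ring
      _ ≤ 4 * s ^ 2 * H := by gcongr
  have hrR : 4 * s ^ 2 * H ≤ (s : ℝ) ^ 3 / 2 := by
    calc 4 * s ^ 2 * H = (s : ℝ) ^ 2 * (8 * H) / 2 := by ring
      _ ≤ (s : ℝ) ^ 2 * s / 2 := by gcongr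
      _ = (s : ℝ) ^ 3 / 2 := by ring
  have hs3 : (0 : ℝ) < (s : ℝ) ^ 3 := by positivity
  let Z : Finset ℂ := (Finset.range (s ^ 2) ×ˢ Finset.range (s ^ 2)).map
    ⟨fun p : ℕ × ℕ => (p.1 + p.2 * σ b : ℂ), nat_add_mul_injective hirr⟩
  have hZmem : ∀ z ∈ Z, ∃ m' n' : ℕ, m' < s ^ 2 ∧ n' < s ^ 2 ∧ (m' + n' * σ b : ℂ) = z := by
    intro z hz
    simp only [Z, Finset.mem_map, Finset.mem_product, Finset.mem_range] at hz
    obtain ⟨p, ⟨h1, h2⟩, h⟩ := hz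
    exact ⟨p.1, p.2, h1, h2, h⟩
  have hss : s ^ 2 ≤ (s + 1) ^ 2 := Nat.pow_le_pow_left (by omega) 2
  -- The radius `s ^ 3` keeps the growth at `exp (7 * s ^ 4)` up to powers `s ^ O(s ^ 3)`, while
  -- each of the `s ^ 4` zeros gains a factor of order `1 / s`.
  have hschwarz := norm_le_mul_pow_of_zeros (Z := Z)
    (differentiable_expPoly fun i => σ (a i))
    (fun z hz => by
      obtain ⟨m', n', h1, h2, rfl⟩ := hZmem z hz
      exact h0 m' n' h1 h2)
    (r := 4 * s ^ 2 * H) (R := (s : ℝ) ^ 3) (by linarith)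
    (fun z hz => by
      obtain ⟨m', n', h1, h2, rfl⟩ := hZmem z hz
      exact hpt m' n' (h1.trans_le hss) (h2.trans_le hss))
    (fun z hz => (norm_expPoly_le
      (fun i => (norm_embedding_le_house (a i : K) σ).trans (ha i))
      (one_le_pow₀ hs1) hz).trans (growth_le hts (by omega)))
    (hpt m n hm hn)
  have hZcard : Z.card = s ^ 4 := by
    simp only [Z, Finset.card_map, Finset.card_product, Finset.card_range]
    ring
  have hratio : 2 * (4 * s ^ 2 * H) / ((s : ℝ) ^ 3 - 4 * s ^ 2 * H) ≤ 16 * H / s := by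
    rw [div_le_div_iff₀ (by linarith) hs0]
    have : 16 * H * ((s : ℝ) ^ 3 / 2) ≤ 16 * H * ((s : ℝ) ^ 3 - 4 * s ^ 2 * H) := by
      gcongr
      linarith
    linarith
  have hσle : ‖σ ξ‖ ≤ (s : ℝ) ^ (30 * s ^ 3) * (16 * H * Real.exp 7 / s) ^ s ^ 4 := by
    rw [hσξ, norm_mul, norm_pow, Complex.norm_natCast]
    have hcE : (c : ℝ) ^ E ≤ (s : ℝ) ^ (6 * s ^ 3) := by
      have hcs : (c : ℝ) ≤ s := (le_mul_of_one_le_right (by linarith) hH).trans hcHs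
      exact (pow_le_pow_left₀ (by linarith) hcs _).trans
        (pow_le_pow_right₀ hs1 (exponent_le hts hs))
    rw [hZcard] at hschwarz
    have hpos : 0 ≤ 2 * (4 * s ^ 2 * H) / ((s : ℝ) ^ 3 - 4 * s ^ 2 * H) :=
      div_nonneg (by positivity) (by linarith)
    calc (c : ℝ) ^ E * ‖expPoly (fun i => σ (a i)) (m + n * σ b)‖
        ≤ (s : ℝ) ^ (6 * s ^ 3) * ((s : ℝ) ^ (24 * s ^ 3) * Real.exp 7 ^ s ^ 4 *
          (16 * H / s) ^ s ^ 4) := by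
          gcongr
          exact hschwarz.trans (by gcongr)
      _ = (s : ℝ) ^ (30 * s ^ 3) * (16 * H * Real.exp 7 / s) ^ s ^ 4 := by
        rw [mul_assoc _ (Real.exp 7 ^ s ^ 4), ← mul_pow, ← mul_assoc, ← pow_add]
        congr 2 <;> ring
  have hfinal : (1 : ℝ) ≤ (s : ℝ) ^ (30 * Module.finrank ℚ K * s ^ 3) *
      (16 * H * Real.exp 7 / s) ^ s ^ 4 := by
    calc (1 : ℝ) ≤ ‖σ ξ‖ * house ξ ^ (Module.finrank ℚ K - 1) :=
          one_le_norm_mul_house_pow hξint hξ0 σ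
      _ ≤ ((s : ℝ) ^ (30 * s ^ 3) * (16 * H * Real.exp 7 / s) ^ s ^ 4) *
          ((s : ℝ) ^ (30 * s ^ 3)) ^ (Module.finrank ℚ K - 1) := by
        have := house_nonneg ξ
        gcongr
      _ = (s : ℝ) ^ (30 * Module.finrank ℚ K * s ^ 3) *
          (16 * H * Real.exp 7 / s) ^ s ^ 4 := by
        obtain ⟨d, hd'⟩ := Nat.exists_eq_succ_of_ne_zero
          (Module.finrank_pos (R := ℚ) (M := K)).ne'
        rw [hd', Nat.succ_sub_one, mul_right_comm, ← pow_succ', ← pow_mul, Nat.succ_eq_add_one]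
        congr 2
        ring
  exact absurd hfinal (not_le.2 (pow_lt_of_sq_lt hs1 hGs hd (by omega)))

theorem exp_two_pi_I_mul_ne {b g : K} (σ : K →+* ℂ) (hirr : ∀ q : ℚ, σ b ≠ q) :
    Complex.exp (2 * Real.pi * Complex.I * σ b) ≠ σ g := by
  intro hbg
  obtain ⟨c, hc, hcb, hcg⟩ : ∃ c : ℕ, 1 ≤ c ∧ IsIntegral ℤ (c * b) ∧ IsIntegral ℤ (c * g) := by
    have halg : ∀ x : K, IsAlgebraic ℤ x := fun x =>
      (IsFractionRing.isAlgebraic_iff ℤ ℚ K).2 (Algebra.IsAlgebraic.isAlgebraic x)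
    have hn := isIntegral_natCast_int (R := K)
    refine ⟨Algebra.natDenominator b * Algebra.natDenominator g, Nat.one_le_iff_ne_zero.2
      (mul_ne_zero (halg b).natDenominator_ne_zero (halg g).natDenominator_ne_zero), ?_, ?_⟩
    · have := (hn (Algebra.natDenominator g)).mul (Algebra.isIntegral_natDenominator_smul b)
      rw [nsmul_eq_mul] at this
      rwa [← mul_assoc, ← Nat.cast_mul, mul_comm (Algebra.natDenominator g)] at this
    · have := (hn (Algebra.natDenominator b)).mul (Algebra.isIntegral_natDenominator_smul g)
      rw [nsmul_eq_mul] at this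
      rwa [← mul_assoc, ← Nat.cast_mul] at this
  obtain ⟨H, hb, hg⟩ : ∃ H : ℝ, 1 + house b ≤ H ∧ house g ≤ H :=
    ⟨_, le_max_left _ _, le_max_right _ _⟩
  have hH : 1 ≤ H := by linarith [house_nonneg b]
  have hc1 : (1 : ℝ) ≤ c := by exact_mod_cast hc
  obtain ⟨C, hC1, hC⟩ := exists_siegel_coeffs hc hcb hcg hH hb hg
  -- One `t` above all thresholds; none of them depends on `t`.
  obtain ⟨t, ht⟩ := exists_nat_gt (4 + C + 8 * H + c * H + (16 * H * Real.exp 7) ^ 2 +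
    2 * (30 * Module.finrank ℚ K))
  have hcH : 1 ≤ c * H := one_le_mul_of_one_le_of_one_le hc1 hH
  have hG : 0 ≤ (16 * H * Real.exp 7) ^ 2 := by positivity
  have hd : (0 : ℝ) ≤ 2 * (30 * Module.finrank ℚ K) := by positivity
  have ht4 : 4 ≤ t := by
    have : (4 : ℝ) ≤ t := by linarith
    exact_mod_cast this
  obtain ⟨a, ha0, hav, hah⟩ := hC t (by omega)
  have hvanish : ∀ s, t ≤ s → ∀ m n : ℕ, m < s ^ 2 → n < s ^ 2 →
      expPoly (fun i => σ (a i)) (m + n * σ b) = 0 := by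
    intro s hts
    induction s, hts using Nat.le_induction with
    | base =>
      intro m n hm hn
      rw [← map_sum_eq_expPoly σ hbg, hav m n hm hn, map_zero]
    | succ s hts ih =>
      intro m n hm hn
      have hts' : (t : ℝ) ≤ s := by exact_mod_cast hts
      refine expPoly_vanishes_on_larger_grid hc hcb hcg hb hg σ hirr hbg hts (by omega)
        (by linarith) (by linarith) (by linarith) ?_ (fun i => (hah i).trans ?_) ih hm hn
      · have : 2 * (30 * (Module.finrank ℚ K : ℝ)) ≤ s := by linarith
        exact_mod_cast this
      · exact siegel_bound_le hcH (by omega) hts (by linarith) (by linarith)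
  have hzero : (fun i => σ (a i : K)) = 0 := by
    refine eq_zero_of_expPoly_eq_zero hirr fun m n => ?_
    refine hvanish (t + m + n) (by omega) m n ?_ ?_ <;>
      exact lt_of_lt_of_le (by omega) (Nat.le_self_pow two_ne_zero _)
  refine ha0 (funext fun i => ?_)
  have := congrFun hzero i
  simpa using this

/-- The Gelfond-Schneider theorem for the values of `1 ^ β`. -/
theorem transcendental_exp_two_pi_I_mul {β : ℂ} (hβ : IsAlgebraic ℚ β) (hq : ∀ q : ℚ, β ≠ q) :
    Transcendental ℚ (Complex.exp (2 * Real.pi * Complex.I * β)) := by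
  intro hγ
  set γ := Complex.exp (2 * Real.pi * Complex.I * β) with hγdef
  let K := IntermediateField.adjoin ℚ ({β, γ} : Set ℂ)
  have hfin : FiniteDimensional ℚ K := IntermediateField.finiteDimensional_adjoin (by
    rintro x (rfl | rfl)
    exacts [hβ.isIntegral, hγ.isIntegral])
  have : NumberField K := ⟨⟩
  have hβK : β ∈ K := IntermediateField.subset_adjoin _ _ (by simp)
  have hγK : γ ∈ K := IntermediateField.subset_adjoin _ _ (by simp)
  exact exp_two_pi_I_mul_ne (K := K) (b := ⟨β, hβK⟩) (g := ⟨γ, hγK⟩) (algebraMap K ℂ) hq rfl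

end NumberField

/-! ### Reduction of the six functions to the exponential -/

theorem isAlgebraic_exp_mul_I_of_cos_sq {θ : ℂ} (h : IsAlgebraic ℚ (Complex.cos θ ^ 2)) :
    IsAlgebraic ℚ (Complex.exp (θ * Complex.I)) := by
  have hs : IsAlgebraic ℚ (Complex.sin θ ^ 2) := by
    rw [Complex.sin_sq]
    exact isAlgebraic_one.sub h
  have hI : IsAlgebraic ℚ Complex.I :=
    IsAlgebraic.of_pow two_pos (by rw [Complex.I_sq]; exact isAlgebraic_one.neg)
  rw [Complex.exp_mul_I]
  exact (h.of_pow two_pos).add ((hs.of_pow two_pos).mul hI)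

namespace BasicTrig

/-- In all six cases `cos θ ^ 2` is a rational function of `x ^ 2`, so no choice of sign arises. -/
theorem isAlgebraic_cos_sq {t : BasicTrig} {x : ℝ} (hx : IsAlgebraic ℚ x) {θ : ℂ}
    (hθ : θ ∈ t.arcValues x) : IsAlgebraic ℚ (Complex.cos θ ^ 2) := by
  have hx2 : IsAlgebraic ℚ ((x : ℂ) ^ 2) := (hx.algebraMap (A := ℂ)).pow 2
  have h1 := isAlgebraic_one (R := ℚ) (A := ℂ)
  have hpos : (1 + (x : ℂ) ^ 2) ≠ 0 := by
    have : (1 + x ^ 2 : ℝ) ≠ 0 := by positivity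
    exact_mod_cast this
  have hcs := Complex.sin_sq_add_cos_sq θ
  obtain ⟨hd, he⟩ := hθ
  cases t <;> simp only [domain, eval, Set.mem_ofPred_eq] at hd he
  · rw [he]; exact hx2
  · rw [Complex.cos_sq', he]; exact h1.sub hx2
  · have : Complex.cos θ ^ 2 = (1 + (x : ℂ) ^ 2)⁻¹ := by
      rw [Complex.tan_eq_sin_div_cos, div_eq_iff hd] at he
      refine eq_inv_of_mul_eq_one_left ?_
      rw [he] at hcs
      linear_combination hcs
    rw [this]; exact (h1.add hx2).inv
  · have : Complex.cos θ ^ 2 = ((x : ℂ) ^ 2)⁻¹ := by rw [← he]; simp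
    rw [this]; exact hx2.inv
  · have : Complex.cos θ ^ 2 = 1 - ((x : ℂ) ^ 2)⁻¹ := by rw [← he, Complex.cos_sq']; simp
    rw [this]; exact h1.sub hx2.inv
  · have : Complex.cos θ ^ 2 = (x : ℂ) ^ 2 * (1 + (x : ℂ) ^ 2)⁻¹ := by
      rw [Complex.cot_eq_cos_div_sin, div_eq_iff hd] at he
      rw [eq_mul_inv_iff_mul_eq₀ hpos]
      rw [he] at hcs ⊢
      linear_combination (x : ℂ) ^ 2 * hcs
    rw [this]; exact hx2.mul (h1.add hx2).inv

theorem arc_mem_arcValues {t : BasicTrig} {x : ℝ} (hx : x ∈ t.arcDomain) :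
    (t.arc x : ℂ) ∈ t.arcValues x := by
  have hinv : 1 ≤ |x| → x ≠ 0 ∧ -1 ≤ 1 / x ∧ 1 / x ≤ 1 := fun h => by
    have h0 : x ≠ 0 := by rintro rfl; norm_num at h
    refine ⟨h0, abs_le.1 ?_⟩
    rw [abs_div, abs_one]
    exact div_le_one_of_le₀ h (abs_nonneg x)
  cases t <;> simp only [arcDomain, Set.mem_Icc, Set.mem_ofPred_eq] at hx <;>
    simp only [arcValues, domain, eval, arc, Set.mem_ofPred_eq]
  · refine ⟨trivial, ?_⟩
    rw [← Complex.ofReal_cos, Real.cos_arccos hx.1 hx.2]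
  · refine ⟨trivial, ?_⟩
    rw [← Complex.ofReal_sin, Real.sin_arcsin hx.1 hx.2]
  · rw [← Complex.ofReal_cos, ← Complex.ofReal_tan, Real.tan_arctan]
    exact ⟨by exact_mod_cast (Real.cos_arctan_pos x).ne', rfl⟩
  · obtain ⟨h0, h1, h2⟩ := hinv hx
    rw [← Complex.ofReal_cos, Real.cos_arccos h1 h2]
    exact ⟨by simpa using h0, by simp⟩
  · obtain ⟨h0, h1, h2⟩ := hinv hx
    rw [← Complex.ofReal_sin, Real.sin_arcsin h1 h2]
    exact ⟨by simpa using h0, by simp⟩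
  · rw [← Complex.ofReal_sin, ← Complex.ofReal_cot, Real.cot_eq_cos_div_sin, Real.sin_pi_div_two_sub,
      Real.cos_pi_div_two_sub, ← Real.tan_eq_sin_div_cos, Real.tan_arctan]
    exact ⟨by exact_mod_cast (Real.cos_arctan_pos x).ne', rfl⟩

theorem exists_rat_or_transcendental_of_mem_arcValues {t : BasicTrig} {x : ℝ}
    (hx : IsAlgebraic ℚ x) {θ : ℂ} (hθ : θ ∈ t.arcValues x) :
    (∃ q : ℚ, θ / (Real.pi : ℂ) = (q : ℂ)) ∨ Transcendental ℚ (θ / (Real.pi : ℂ)) := by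
  by_contra! h
  obtain ⟨hq, ha⟩ := h
  refine transcendental_exp_two_pi_I_mul (not_not.1 ha) hq ?_
  have hπ : (Real.pi : ℂ) ≠ 0 := by exact_mod_cast Real.pi_ne_zero
  rw [show 2 * Real.pi * Complex.I * (θ / Real.pi) = (2 : ℕ) * (θ * Complex.I) by
    field_simp; push_cast; ring, Complex.exp_nat_mul]
  exact (isAlgebraic_exp_mul_I_of_cos_sq (isAlgebraic_cos_sq hx hθ)).pow 2

end BasicTrig

theorem theorem1 (t : BasicTrig) (x : ℝ) (hx : IsAlgebraic ℚ x) :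
    (x ∈ t.arcDomain →
      (∃ q : ℚ, t.arc x / Real.pi = (q : ℝ)) ∨ Transcendental ℚ (t.arc x / Real.pi)) ∧
    (∀ θ ∈ t.arcValues x,
      (∃ q : ℚ, θ / (Real.pi : ℂ) = (q : ℂ)) ∨ Transcendental ℚ (θ / (Real.pi : ℂ))) := by
  refine ⟨fun h => ?_, fun θ hθ => BasicTrig.exists_rat_or_transcendental_of_mem_arcValues hx hθ⟩
  refine (BasicTrig.exists_rat_or_transcendental_of_mem_arcValues hx
    (BasicTrig.arc_mem_arcValues h)).imp (fun ⟨q, hq⟩ => ⟨q, by exact_mod_cast hq⟩) fun ht ha => ?_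
  refine ht ?_
  have := ha.algebraMap (A := ℂ)
  simpa using this
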